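/- Let $\mathbb Z/2$ act on $\mathbb R^{p,q}=(\mathbb R^{1,0})^{p-q}\oplus(\mathbb R^{1,1})^{q}$, where $\mathbb R^{1,0}$ and $\mathbb R^{1,1}$ are the trivial and the sign representation, and give the Grassmann manifold $G_n(\mathbb R^{p,q})$ of $n$-dimensional linear subspaces the induced action. Let $\sigma=(\sigma_1,\dots,\sigma_n)$ be a Schubert symbol, i.e. a sequence of integers with $1\le\sigma_1<\dots<\sigma_n\le p$, and let $\varphi=(\varphi_1,\dots,\varphi_q)$ be a flag symbol, i.e. a sequence of integers with $1\le\varphi_1<\dots<\varphi_q\le p$. Let $0=V_0\subset V_1\subset\dots\subset V_p=\mathbb R^{p,q}$ be a flag of subrepresentations determined by $\varphi$: each $V_i$ is obtained from $V_{i-1}$ by adjoining a coordinate basis vector, and $V_i/V_{i-1}$ is $\mathbb R^{1,1}$ if $i\in\{\varphi_1,\dots,\varphi_q\}$ and $\mathbb R^{1,0}$ otherwise. Let $$e(\sigma,\varphi)=\{\ell\in G_n(\mathbb R^{p,q}) : \dim(\ell\cap V_{\sigma_i})=1+\dim(\ell\cap V_{\sigma_i-1})\ \text{ for } i=1,\dots,n\}$$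 be the corresponding Schubert cell. Write $\varphi$ also for the set $\{\varphi_1,\dots,\varphi_q\}$, and put $\underline{\sigma_i}=\{1,\dots,\sigma_i\}$, $\sigma(i)=\{\sigma_1,\dots,\sigma_i\}$, and $$a=\sum_{i=1}^n(\sigma_i-i),\qquad b=\sum_{\sigma_i\in\varphi}\bigl|\underline{\sigma_i}\setminus(\varphi\cup\sigma(i))\bigr|+\sum_{\sigma_i\notin\varphi}\bigl|(\underline{\sigma_i}\cap\varphi)\setminus\sigma(i)\bigr| .$$ Then $e(\sigma,\varphi)$ is a representation cell of bidegree $(a,b)$. That is, $b\le a$, and there is a continuous $\mathbb Z/2$-equivariant map from the closed unit disk $D(\mathbb R^{a,b})$ to $G_n(\mathbb R^{p,q})$ that restricts to a homeomorphism from the interior of the disk onto $e(\sigma,\varphi)$ and maps the unit sphere $S(\mathbb R^{a,b})$ into the union of the Schubert cells $e(\tau,\varphi)$ (for the same flag) with $\sum_{i=1}^n(\tau_i-i)<a$. -/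

import Mathlib

namespace RepGrassmann

/-- The underlying Euclidean space `ℝ^p` of the representation `ℝ^{p,q}`. -/
abbrev E (p : ℕ) : Type := EuclideanSpace ℝ (Fin p)

/-- The sign by which the generator of `ℤ/2` acts on the `k`-th coordinate (counted from `0`) of
`ℝ^{p,q} = (ℝ^{1,0})^{p-q} ⊕ (ℝ^{1,1})^q`, for `q ≤ p`: the first `p - q` coordinates are fixed,
the last `q` coordinates are negated. -/
def sgn (p q : ℕ) (k : Fin p) : ℝ := if (k : ℕ) + q < p then 1 else -1

theorem sgn_mul_self (p q : ℕ) (k : Fin p) : sgn p q k * sgn p q k = 1 := by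
  unfold sgn
  split <;> norm_num

/-- The action of the generator of `ℤ/2` on `ℝ^{p,q}`; it is a linear involution. -/
def act (p q : ℕ) : E p ≃ₗ[ℝ] E p where
  toFun x := WithLp.toLp 2 fun k => sgn p q k * x k
  invFun x := WithLp.toLp 2 fun k => sgn p q k * x k
  map_add' x y := by
    ext k
    simp [mul_add]
  map_smul' c x := by
    ext k
    simp [mul_left_comm]
  left_inv x := by
    ext k
    simp [← mul_assoc, sgn_mul_self]
  right_inv x := by
    ext k
    simp [← mul_assoc, sgn_mul_self]

/-- The set `G_n(ℝ^p)` of `n`-dimensional linear subspaces of `ℝ^p`. -/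
def Grassmannian (n p : ℕ) : Type :=
  {l : Submodule ℝ (E p) // Module.finrank ℝ l = n}

/-- The `n`-frames in `ℝ^p` (linearly independent `n`-tuples), topologized as a subspace of
`(ℝ^p)^n`. -/
abbrev Frame (n p : ℕ) : Type := {v : Fin n → E p // LinearIndependent ℝ v}

/-- The subspace spanned by a frame. -/
def Frame.toGrassmannian {n p : ℕ} (v : Frame n p) : Grassmannian n p :=
  ⟨Submodule.span ℝ (Set.range v.1), by simpa using finrank_span_eq_card v.2⟩

/-- The usual topology of the Grassmann manifold: the quotient topology from the space of
frames. -/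
instance (n p : ℕ) : TopologicalSpace (Grassmannian n p) :=
  TopologicalSpace.coinduced (Frame.toGrassmannian (n := n) (p := p)) inferInstance

/-- The induced action of the generator of `ℤ/2` on `G_n(ℝ^{p,q})`. -/
def Grassmannian.act {n p : ℕ} (q : ℕ) (l : Grassmannian n p) : Grassmannian n p :=
  ⟨l.1.map (RepGrassmann.act p q).toLinearMap, by
    rw [LinearEquiv.finrank_map_eq]
    exact l.2⟩

/-- A flag symbol `1 ≤ φ_1 < ⋯ < φ_q ≤ p` for `ℝ^{p,q}`. -/
structure FlagSymbol (p q : ℕ) where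
  seq : Fin q → ℕ
  strictMono : StrictMono seq
  one_le : ∀ i, 1 ≤ seq i
  le : ∀ i, seq i ≤ p

/-- The set of the entries of a flag symbol. -/
def FlagSymbol.entries {p q : ℕ} (φ : FlagSymbol p q) : Finset ℕ :=
  Finset.univ.image φ.seq

/-- A Schubert symbol `1 ≤ σ_1 < ⋯ < σ_n ≤ p`; the entry `σ_{i+1}` is `seq i`. -/
structure SchubertSymbol (n p : ℕ) where
  seq : Fin n → ℕ
  strictMono : StrictMono seq
  one_le : ∀ i, 1 ≤ seq i
  le : ∀ i, seq i ≤ p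

/-- `V_0 ⊂ V_1 ⊂ ⋯ ⊂ V_p` is a flag of subrepresentations of `ℝ^{p,q}` of the kind determined by
the flag symbol `φ`: each `V_i` arises from `V_{i-1}` by adjoining a coordinate basis vector, and
the one-dimensional representation `V_i / V_{i-1}` is `ℝ^{1,1}` (the generator of `ℤ/2` acts on it
as `-1`) if `i` is an entry of `φ` and `ℝ^{1,0}` (the generator acts as the identity) otherwise.
Only the values `V i` with `i ≤ p` matter. -/
structure IsFlag {p q : ℕ} (φ : FlagSymbol p q) (V : ℕ → Submodule ℝ (E p)) : Prop where
  zero : V 0 = ⊥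
  top : V p = ⊤
  adjoin : ∀ i, 1 ≤ i → i ≤ p → ∃ k : Fin p, EuclideanSpace.single k (1 : ℝ) ∉ V (i - 1) ∧
    V i = V (i - 1) ⊔ Submodule.span ℝ {EuclideanSpace.single k (1 : ℝ)}
  invariant : ∀ i, i ≤ p → ∀ v ∈ V i, act p q v ∈ V i
  twisted : ∀ i, 1 ≤ i → i ≤ p → i ∈ φ.entries → ∀ v ∈ V i, act p q v - (-v) ∈ V (i - 1)
  untwisted : ∀ i, 1 ≤ i → i ≤ p → i ∉ φ.entries → ∀ v ∈ V i, act p q v - v ∈ V (i - 1)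

namespace SchubertSymbol

variable {n p : ℕ}

/-- The Schubert cell `e(σ, V)` of a flag `V`: the subspaces `l` with
`dim (l ∩ V_{σ_i}) = 1 + dim (l ∩ V_{σ_i - 1})` for all `i`. -/
def cell (σ : SchubertSymbol n p) (V : ℕ → Submodule ℝ (E p)) : Set (Grassmannian n p) :=
  {l | ∀ i, Module.finrank ℝ (l.1 ⊓ V (σ.seq i) : Submodule ℝ (E p)) =
    1 + Module.finrank ℝ (l.1 ⊓ V (σ.seq i - 1) : Submodule ℝ (E p))}

/-- `∑ (σ_i - i)`. No subtraction truncates, since `i ≤ σ_i`. -/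
def dim (σ : SchubertSymbol n p) : ℕ := ∑ i, (σ.seq i - ((i : ℕ) + 1))

/-- `{σ_1, …, σ_i}`. -/
def initial (σ : SchubertSymbol n p) (i : Fin n) : Finset ℕ := (Finset.Iic i).image σ.seq

/-- The number of twists
`∑_{σ_i ∈ φ} |{1,…,σ_i} \ (φ ∪ {σ_1,…,σ_i})| + ∑_{σ_i ∉ φ} |({1,…,σ_i} ∩ φ) \ {σ_1,…,σ_i}|`. -/
def twists {q : ℕ} (σ : SchubertSymbol n p) (φ : FlagSymbol p q) : ℕ :=
  ∑ i with σ.seq i ∈ φ.entries,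
      (Finset.Icc 1 (σ.seq i) \ (φ.entries ∪ σ.initial i)).card +
    ∑ i with σ.seq i ∉ φ.entries,
      ((Finset.Icc 1 (σ.seq i) ∩ φ.entries) \ σ.initial i).card

end SchubertSymbol

/-- The union of the Schubert cells (for the flag `V`) of dimension less than `d`. -/
def skeletonBelow {p : ℕ} (n : ℕ) (V : ℕ → Submodule ℝ (E p)) (d : ℕ) :
    Set (Grassmannian n p) :=
  {l | ∃ τ : SchubertSymbol n p, τ.dim < d ∧ l ∈ τ.cell V}

/-- Let `X` be a space with an involution `g`. The subset `e` of `X` is a representation cell of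
bidegree `(a, b)` attached to the subset `A`: there is a continuous equivariant map `Φ` from the
unit disk `D(ℝ^{a,b})` to `X` which restricts to a homeomorphism from the interior of the disk onto
`e` and maps the unit sphere `S(ℝ^{a,b})` into `A`. -/
def IsRepCell {X : Type*} [TopologicalSpace X] (g : X → X) (A e : Set X) (a b : ℕ) : Prop :=
  b ≤ a ∧ ∃ Φ : E a → X,
    ContinuousOn Φ (Metric.closedBall 0 1) ∧
    (∀ x ∈ Metric.closedBall (0 : E a) 1, Φ (act a b x) = g (Φ x)) ∧
    Topology.IsEmbedding ((Metric.ball (0 : E a) 1).domRestrict Φ) ∧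
    Φ '' Metric.ball 0 1 = e ∧
    Set.MapsTo Φ (Metric.sphere 0 1) A

end RepGrassmann

/-!
Relative to the flag of a basis `b` permuting the standard one, a plane whose Schubert symbol is `s`
(counted from `0`) contains exactly one orthonormal frame whose `i`-th vector lies in the flag up to
`b (s i)` with a negative component along `b (s i)`. These frames are parametrized by the matrices
in echelon form with pivots `s` and rows `b (s i) + t i` with `‖t i‖ < 1`: apply to all `b (s i)`
the product of the reflections in the hyperplanes orthogonal to the rows. If `‖t i‖ = 1` for some
`i`, then the component of the `i`-th vector along `b (s i)` vanishes, and the plane lies in a cell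
of smaller dimension. The rows thus range over a product of balls, which a radial rescaling turns
into a disk, and compactness of the disk makes the parametrization of the open cell a homeomorphism.

A reflection depends only on the line spanned by its row. Hence the plane depends equivariantly on
the matrix when the generator of `ℤ/2` multiplies each row, after acting on it, by the sign of its
pivot. It then multiplies the entry in column `j` of row `i` by the product of the signs of `b j`
and `b (s i)`, and the number of twists counts the entries for which this product is `-1`.
-/

namespace RepGrassmann

open Module

section Jumps

open Finset

variable {p : ℕ} {K M : Type*} [DivisionRing K] [AddCommGroup M] [Module K M]
  (b : Basis (Fin p) K M)

theorem sup_flag_castSucc_eq {W : Submodule K M} {k : Fin p} (hW : W ≤ b.flag k.succ)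
    (hW' : ¬ W ≤ b.flag k.castSucc) : b.flag k.castSucc ⊔ W = b.flag k.succ :=
  ((b.flag_covBy k).eq_or_eq le_sup_left (sup_le (b.flag_covBy k).le hW)).resolve_left
    fun h => hW' (le_sup_right.trans h.le)

theorem finrank_flag (k : Fin (p + 1)) : finrank K (b.flag k) = k := by
  have h := finrank_span_eq_card
    (b.linearIndependent.comp (Subtype.val : {i : Fin p // i.castSucc < k} → Fin p)
      Subtype.val_injective)
  rw [Set.range_comp, Subtype.range_coe_subtype, Fintype.card_subtype] at h
  simp only [Fin.lt_def, Fin.val_castSucc, Fin.card_filter_val_lt] at h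
  exact h.trans (min_eq_right (Nat.lt_succ_iff.1 k.2))

/-- The positions at which the dimension of the intersection of the subspace `l` with the flag of
the basis `b` jumps. -/
noncomputable def jumps (l : Submodule K M) : Finset (Fin p) := by
  classical exact {k | ¬ l ⊓ b.flag k.succ ≤ b.flag k.castSucc}

variable {b} in
theorem mem_jumps {l : Submodule K M} {k : Fin p} :
    k ∈ jumps b l ↔ ¬ l ⊓ b.flag k.succ ≤ b.flag k.castSucc := by
  simp [jumps]

variable (l : Submodule K M)

theorem finrank_inf_flag_succ (k : Fin p) :
    finrank K (l ⊓ b.flag k.succ : Submodule K M) =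
      finrank K (l ⊓ b.flag k.castSucc : Submodule K M) + if k ∈ jumps b l then 1 else 0 := by
  have := Module.Finite.of_basis b
  have hle : b.flag k.castSucc ≤ b.flag k.succ := (b.flag_covBy k).le
  split_ifs with hk
  · have h := Submodule.finrank_sup_add_finrank_inf_eq (b.flag k.castSucc) (l ⊓ b.flag k.succ)
    rw [sup_flag_castSucc_eq b inf_le_right (mem_jumps.1 hk), inf_left_comm, inf_eq_left.2 hle,
      finrank_flag, finrank_flag, Fin.val_succ, Fin.val_castSucc] at h
    omega
  · have h : l ⊓ b.flag k.succ = l ⊓ b.flag k.castSucc :=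
      le_antisymm (le_inf inf_le_left (not_not.1 (mt mem_jumps.2 hk))) (inf_le_inf_left l hle)
    rw [h, add_zero]

theorem finrank_inf_flag (m : Fin (p + 1)) :
    finrank K (l ⊓ b.flag m : Submodule K M) = #{k ∈ jumps b l | k.castSucc < m} := by
  induction m using Fin.induction with
  | zero => rw [b.flag_zero, inf_bot_eq]; simp
  | succ m ih =>
    have h : {k ∈ jumps b l | k.castSucc < m.succ} =
        {k ∈ jumps b l | k.castSucc < m.castSucc} ∪ {k ∈ jumps b l | k = m} := by
      ext k
      simp only [mem_filter, mem_union, ← and_or_left,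
        Fin.castSucc_lt_succ_iff, Fin.castSucc_lt_castSucc_iff, le_iff_lt_or_eq]
    rw [finrank_inf_flag_succ, ih, h, card_union_of_disjoint, filter_eq']
    · split_ifs <;> simp
    · exact disjoint_filter.2 fun k _ hk hkm => hk.ne (congrArg _ hkm)

theorem card_jumps : #(jumps b l) = finrank K l := by
  have h := finrank_inf_flag b l (Fin.last p)
  rw [b.flag_last, inf_top_eq, filter_true_of_mem fun k _ => k.castSucc_lt_last] at h
  exact h.symm

end Jumps

section SchubertSymbols

open Finset

namespace SchubertSymbol

variable {n p : ℕ} (σ : SchubertSymbol n p)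

/-- The entries of a Schubert symbol, counted from `0`: they number the vectors of a basis of `ℝ^p`
whereas `seq` numbers the steps of its flag. -/
def index (i : Fin n) : Fin p :=
  ⟨σ.seq i - 1, (Nat.sub_one_lt_of_le (σ.one_le i) le_rfl).trans_le (σ.le i)⟩

theorem index_add_one (i : Fin n) : (σ.index i : ℕ) + 1 = σ.seq i :=
  Nat.sub_add_cancel (σ.one_le i)

theorem index_strictMono : StrictMono σ.index := fun i _ hij =>
  Nat.sub_lt_sub_right (σ.one_le i) (σ.strictMono hij)

theorem le_index (i : Fin n) : (i : ℕ) ≤ σ.index i := by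
  have h : (Iio i).image σ.index ⊆ Iio (σ.index i) := image_subset_iff.2 fun _ hj =>
    mem_Iio.2 (σ.index_strictMono (mem_Iio.1 hj))
  simpa [card_image_of_injective _ σ.index_strictMono.injective] using card_le_card h

theorem index_injective : Function.Injective (index : SchubertSymbol n p → Fin n → Fin p) := by
  rintro ⟨s, _, hs, _⟩ ⟨t, _, ht, _⟩ h
  obtain rfl : s = t := funext fun i => by
    have := congrArg Fin.val (congrFun h i)
    have := hs i
    have := ht i
    simp only [index] at *
    omega
  rfl

theorem dim_eq_sum : σ.dim = ∑ i, ((σ.index i : ℕ) - i) := by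
  simp only [dim, ← index_add_one, Nat.add_sub_add_right]

variable {σ} in
theorem dim_lt_dim {τ : SchubertSymbol n p} (hle : ∀ i, τ.index i ≤ σ.index i) {k : Fin n}
    (hlt : τ.index k < σ.index k) : τ.dim < σ.dim := by
  rw [dim_eq_sum, dim_eq_sum]
  exact sum_lt_sum (fun i _ => Nat.sub_le_sub_right (hle i) _)
    ⟨k, mem_univ k, Nat.sub_lt_sub_right (τ.le_index k) hlt⟩

/-- The Schubert symbol with given entries, counted from `0`. -/
def ofIndex (f : Fin n ↪o Fin p) : SchubertSymbol n p where
  seq i := f i + 1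
  strictMono _ _ hij := Nat.succ_lt_succ (f.strictMono hij)
  one_le _ := Nat.le_add_left _ _
  le i := (f i).2

theorem index_ofIndex (f : Fin n ↪o Fin p) : (ofIndex f).index = f := rfl

end SchubertSymbol

namespace Grassmannian

variable {n p : ℕ} (b : Basis (Fin p) ℝ (E p)) (l : Grassmannian n p)

/-- The Schubert symbol of an `n`-plane relative to the flag of a basis. -/
noncomputable def schubertSymbol : SchubertSymbol n p :=
  .ofIndex ((jumps b l.1).orderEmbOfFin ((card_jumps b l.1).trans l.2))

theorem index_schubertSymbol_eq_iff {s : Fin n → Fin p} (hs : StrictMono s) :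
    (l.schubertSymbol b).index = s ↔ ∀ i, s i ∈ jumps b l.1 := by
  rw [schubertSymbol, SchubertSymbol.index_ofIndex]
  refine ⟨?_, fun h => (orderEmbOfFin_unique _ h hs).symm⟩
  rintro rfl i
  exact orderEmbOfFin_mem _ _ i

theorem range_index_schubertSymbol : Set.range (l.schubertSymbol b).index = jumps b l.1 :=
  range_orderEmbOfFin _ ((card_jumps b l.1).trans l.2)

theorem index_schubertSymbol_lt {i : Fin n} {m : Fin (p + 1)}
    (h : i < finrank ℝ (l.1 ⊓ b.flag m : Submodule ℝ (E p))) :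
    ((l.schubertSymbol b).index i).castSucc < m := by
  set s := (l.schubertSymbol b).index
  by_contra! hm
  have hsub : {k ∈ jumps b l.1 | k.castSucc < m} ⊆ (Iio i).image s := fun k hk => by
    obtain ⟨hk, hkm⟩ := mem_filter.1 hk
    obtain ⟨j, rfl⟩ := (l.range_index_schubertSymbol b).ge (mem_coe.2 hk)
    exact mem_image_of_mem s
      (mem_Iio.2 ((l.schubertSymbol b).index_strictMono.lt_iff_lt.1 (hkm.trans_le hm)))
  have hcard := (card_le_card hsub).trans card_image_le
  rw [← finrank_inf_flag, Fin.card_Iio] at hcard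
  exact h.not_ge hcard

theorem index_schubertSymbol_lt_of_linearIndependent {x : Fin n → E p}
    (hx : LinearIndependent ℝ x) (hxl : ∀ i, x i ∈ l.1) {i : Fin n} {m : Fin (p + 1)}
    (h : ∀ j ≤ i, x j ∈ b.flag m) : ((l.schubertSymbol b).index i).castSucc < m := by
  refine l.index_schubertSymbol_lt b ?_
  let y : Iic i → (l.1 ⊓ b.flag m : Submodule ℝ (E p)) :=
    fun j => ⟨x j, hxl j, h j (mem_Iic.1 j.2)⟩
  have hy : LinearIndependent ℝ y :=
    LinearIndependent.of_comp (Submodule.subtype _) (hx.comp _ Subtype.val_injective)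
  have hcard := hy.fintype_card_le_finrank
  rwa [Fintype.card_coe, Fin.card_Iic] at hcard

variable {b l} in
theorem dim_schubertSymbol_lt {σ : SchubertSymbol n p} {x : Fin n → E p}
    (hx : LinearIndependent ℝ x) (hxl : ∀ i, x i ∈ l.1)
    (hxσ : ∀ i, x i ∈ b.flag (σ.index i).succ) {k : Fin n}
    (hk : x k ∈ b.flag (σ.index k).castSucc) : (l.schubertSymbol b).dim < σ.dim := by
  refine SchubertSymbol.dim_lt_dim (fun i => ?_) (k := k) ?_
  · refine Fin.castSucc_lt_succ_iff.1
      (l.index_schubertSymbol_lt_of_linearIndependent b hx hxl fun j hj => ?_)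
    exact b.flag_mono (Fin.succ_le_succ_iff.2 (σ.index_strictMono.monotone hj)) (hxσ j)
  · refine Fin.castSucc_lt_castSucc_iff.1
      (l.index_schubertSymbol_lt_of_linearIndependent b hx hxl fun j hj => ?_)
    rcases hj.eq_or_lt with rfl | hj
    · exact hk
    · exact b.flag_mono (Fin.succ_le_castSucc_iff.2 (σ.index_strictMono hj)) (hxσ j)

end Grassmannian

theorem SchubertSymbol.mem_cell_iff {n p : ℕ} {σ : SchubertSymbol n p}
    {b : Basis (Fin p) ℝ (E p)} {V : ℕ → Submodule ℝ (E p)}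
    (hV : ∀ k : Fin (p + 1), V k = b.flag k) {l : Grassmannian n p} :
    l ∈ σ.cell V ↔ l.schubertSymbol b = σ := by
  rw [← index_injective.eq_iff, l.index_schubertSymbol_eq_iff b σ.index_strictMono]
  refine forall_congr' fun i => ?_
  have hsucc := hV (σ.index i).succ
  have hcast := hV (σ.index i).castSucc
  rw [Fin.val_succ, index_add_one] at hsucc
  rw [Fin.val_castSucc, ← Nat.add_sub_cancel (σ.index i : ℕ) 1, index_add_one] at hcast
  rw [hsucc, hcast, finrank_inf_flag_succ]
  split_ifs with h <;> simp [h, add_comm]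

end SchubertSymbols

theorem act_single (p q : ℕ) (k : Fin p) :
    act p q (EuclideanSpace.single k 1) = sgn p q k • EuclideanSpace.single k 1 := by
  ext c
  by_cases hc : c = k
  · subst hc
    simp [act]
  · simp [act, hc]

theorem eq_of_smul_sub_smul_mem {K M : Type*} [DivisionRing K] [AddCommGroup M] [Module K M]
    {W : Submodule K M} {v : M} (hv : v ∉ W) {c d : K} (h : c • v - d • v ∈ W) : c = d := by
  by_contra hne
  rw [← sub_smul, W.smul_mem_iff (sub_ne_zero.2 hne)] at h
  exact hv h

/-- The sign by which the generator of `ℤ/2` acts on the quotient of the `(j + 1)`-st by the `j`-th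
step of a flag with symbol `φ`. -/
def FlagSymbol.sign {p q : ℕ} (φ : FlagSymbol p q) (j : Fin p) : ℝ :=
  if (j : ℕ) + 1 ∈ φ.entries then -1 else 1

theorem FlagSymbol.sign_mul_self {p q : ℕ} (φ : FlagSymbol p q) (j : Fin p) :
    φ.sign j * φ.sign j = 1 := by
  unfold sign
  split_ifs <;> norm_num

namespace IsFlag

variable {p q : ℕ} {φ : FlagSymbol p q} {V : ℕ → Submodule ℝ (E p)}

theorem act_sub_sign_smul_mem (hV : IsFlag φ V) {j : Fin p} {v : E p} (hv : v ∈ V (j + 1)) :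
    act p q v - φ.sign j • v ∈ V j := by
  unfold FlagSymbol.sign
  split_ifs with hj
  · simpa using hV.twisted (j + 1) (Nat.le_add_left 1 j) j.2 hj v hv
  · simpa using hV.untwisted (j + 1) (Nat.le_add_left 1 j) j.2 hj v hv

theorem le_of_le (hV : IsFlag φ V) {i j : ℕ} (hij : i ≤ j) (hj : j ≤ p) : V i ≤ V j := by
  induction j, hij using Nat.le_induction with
  | base => exact le_rfl
  | succ j _ ih =>
    obtain ⟨k, -, hk⟩ := hV.adjoin (j + 1) (Nat.le_add_left 1 j) hj
    exact (ih (Nat.le_of_succ_le hj)).trans (hk ▸ le_sup_left)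

theorem exists_perm (hV : IsFlag φ V) : ∃ κ : Equiv.Perm (Fin p), ∀ j : Fin p,
    EuclideanSpace.single (κ j) (1 : ℝ) ∉ V j ∧
      V (j + 1) = V j ⊔ Submodule.span ℝ {EuclideanSpace.single (κ j) (1 : ℝ)} := by
  choose k hnotMem hsup using fun j : Fin p => hV.adjoin (j + 1) (Nat.le_add_left 1 j) j.2
  simp only [Nat.add_sub_cancel] at hnotMem hsup
  have hne : ∀ i j : Fin p, i < j → k i ≠ k j := fun i j hij heq =>
    hnotMem j (hV.le_of_le (Nat.succ_le_of_lt hij) j.2.le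
      (hsup i ▸ Submodule.mem_sup_right (heq ▸ Submodule.mem_span_singleton_self _)))
  have hinj : Function.Injective k := .of_lt_imp_ne hne
  exact ⟨Equiv.ofBijective k (Finite.injective_iff_bijective.1 hinj),
    fun j => ⟨hnotMem j, hsup j⟩⟩

/-- The basis is a permutation of the standard one, hence orthonormal. -/
theorem exists_orthonormalBasis (hV : IsFlag φ V) : ∃ b : OrthonormalBasis (Fin p) ℝ (E p),
    (∀ k : Fin (p + 1), V k = b.toBasis.flag k) ∧ ∀ j, act p q (b j) = φ.sign j • b j := by
  obtain ⟨κ, hκ⟩ := hV.exists_perm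
  let b := (EuclideanSpace.basisFun (Fin p) ℝ).reindex κ.symm
  have hb : ∀ j, b j = EuclideanSpace.single (κ j) (1 : ℝ) := fun j => by simp [b]
  refine ⟨b, fun k => ?_, fun j => ?_⟩
  · induction k using Fin.induction with
    | zero => rw [Basis.flag_zero, Fin.val_zero, hV.zero]
    | succ k ih => rw [Basis.flag_succ, ← ih, Fin.val_succ, (hκ k).2, sup_comm, Fin.val_castSucc,
        OrthonormalBasis.coe_toBasis, hb]
  · have hmem : b j ∈ V (j + 1) := by
      rw [(hκ j).2, hb]
      exact Submodule.mem_sup_right (Submodule.mem_span_singleton_self _)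
    have h := hV.act_sub_sign_smul_mem hmem
    rw [hb] at h ⊢
    rw [act_single] at h ⊢
    rw [eq_of_smul_sub_smul_mem (hκ j).1 h]

end IsFlag

section Reflections

variable {F G : Type*} [NormedAddCommGroup F] [InnerProductSpace ℝ F] [NormedAddCommGroup G]
  [InnerProductSpace ℝ G]

/-- The orthogonal reflection that negates `u`; it is the identity for `u = 0`. -/
noncomputable def hyperplaneReflection (u : F) : F ≃ₗᵢ[ℝ] F :=
  (ℝ ∙ u)ᗮ.reflection

theorem hyperplaneReflection_apply (u x : F) :
    hyperplaneReflection u x = x - (2 * (inner ℝ u x / ‖u‖ ^ 2)) • u := by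
  rw [hyperplaneReflection, Submodule.reflection_orthogonal_apply,
    Submodule.reflection_singleton_apply]
  simp [mul_smul, ofNat_smul_eq_nsmul]

theorem hyperplaneReflection_of_inner_eq_zero {u x : F} (h : inner ℝ u x = 0) :
    hyperplaneReflection u x = x := by
  simp [hyperplaneReflection_apply, h]

theorem hyperplaneReflection_smul {c : ℝ} (hc : c ≠ 0) (u : F) :
    hyperplaneReflection (c • u) = hyperplaneReflection u := by
  have h : Submodule.span ℝ {c • u} = ℝ ∙ u := Submodule.span_singleton_smul_eq (.mk0 c hc) u
  simp only [hyperplaneReflection, h]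

theorem hyperplaneReflection_map (g : F →ₗᵢ[ℝ] G) (u x : F) :
    hyperplaneReflection (g u) (g x) = g (hyperplaneReflection u x) := by
  simp only [hyperplaneReflection_apply, map_sub, map_smul, g.inner_map_map, g.norm_map]

theorem hyperplaneReflection_sub_mem {W : Submodule ℝ F} {u : F} (hu : u ∈ W) (x : F) :
    hyperplaneReflection u x - x ∈ W := by
  rw [hyperplaneReflection_apply, sub_sub_cancel_left]
  exact W.neg_mem (W.smul_mem _ hu)

theorem continuous_hyperplaneReflection {X : Type*} [TopologicalSpace X] {u z : X → F}
    (hu : Continuous u) (hu0 : ∀ x, u x ≠ 0) (hz : Continuous z) :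
    Continuous fun x => hyperplaneReflection (u x) (z x) := by
  simp only [hyperplaneReflection_apply]
  exact hz.sub (.smul (continuous_const.mul ((hu.inner hz).div (hu.norm.pow 2) fun x =>
    pow_ne_zero 2 (norm_ne_zero_iff.2 (hu0 x)))) hu)

/-- The composite of the reflections that negate `u 0, …, u (n - 1)`; the last one acts first. -/
noncomputable def reflectionProd : {n : ℕ} → (Fin n → F) → (F ≃ₗᵢ[ℝ] F)
  | 0, _ => 1
  | _ + 1, u => reflectionProd (u ∘ Fin.castSucc) * hyperplaneReflection (u (Fin.last _))

theorem reflectionProd_succ_apply {n : ℕ} (u : Fin (n + 1) → F) (x : F) :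
    reflectionProd u x =
      reflectionProd (u ∘ Fin.castSucc) (hyperplaneReflection (u (Fin.last n)) x) := rfl

theorem reflectionProd_smul {n : ℕ} {c : Fin n → ℝ} (hc : ∀ i, c i ≠ 0) (u : Fin n → F) :
    reflectionProd (fun i => c i • u i) = reflectionProd u := by
  induction n with
  | zero => rfl
  | succ n ih =>
    exact congrArg₂ (· * ·) (ih (fun i => hc i.castSucc) (u ∘ Fin.castSucc))
      (hyperplaneReflection_smul (hc _) _)

theorem reflectionProd_map (g : F →ₗᵢ[ℝ] G) {n : ℕ} (u : Fin n → F) (x : F) :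
    reflectionProd (g ∘ u) (g x) = g (reflectionProd u x) := by
  induction n generalizing x with
  | zero => rfl
  | succ n ih =>
    rw [reflectionProd_succ_apply, reflectionProd_succ_apply, Function.comp_apply,
      hyperplaneReflection_map, Function.comp_assoc, ih]

theorem reflectionProd_sub_mem {W : Submodule ℝ F} {n : ℕ} {u : Fin n → F} (hu : ∀ i, u i ∈ W)
    (x : F) : reflectionProd u x - x ∈ W := by
  induction n generalizing x with
  | zero => exact (sub_self x).symm ▸ W.zero_mem
  | succ n ih =>
    rw [reflectionProd_succ_apply, ← sub_add_sub_cancel]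
    exact W.add_mem (ih (fun i => hu i.castSucc) _) (hyperplaneReflection_sub_mem (hu _) x)

theorem continuous_reflectionProd {X : Type*} [TopologicalSpace X] {n : ℕ} {u : X → Fin n → F}
    {z : X → F} (hu : Continuous u) (hu0 : ∀ x i, u x i ≠ 0) (hz : Continuous z) :
    Continuous fun x => reflectionProd (u x) (z x) := by
  induction n generalizing z with
  | zero => exact hz
  | succ n ih =>
    have hlast : Continuous fun x => u x (Fin.last n) := by fun_prop
    exact ih (u := fun x => u x ∘ Fin.castSucc) (by fun_prop) (fun x i => hu0 x i.castSucc)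
      (continuous_hyperplaneReflection hlast (fun x => hu0 x _) hz)

end Reflections

section Stereographic

variable {F : Type*} [NormedAddCommGroup F] [InnerProductSpace ℝ F] {e t : F}

theorem hyperplaneReflection_unit_add (he : ‖e‖ = 1) (ht : inner ℝ e t = 0) :
    hyperplaneReflection (e + t) e = e - (2 / (1 + ‖t‖ ^ 2)) • (e + t) := by
  have hnorm : ‖e + t‖ ^ 2 = 1 + ‖t‖ ^ 2 := by
    rw [norm_add_sq_real, he, ht]
    ring
  rw [hyperplaneReflection_apply, hnorm, inner_add_left, real_inner_self_eq_norm_sq, he,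
    real_inner_comm, ht, one_pow, add_zero, mul_one_div]

theorem inner_hyperplaneReflection_unit_add (he : ‖e‖ = 1) (ht : inner ℝ e t = 0) :
    inner ℝ e (hyperplaneReflection (e + t) e) = 1 - 2 / (1 + ‖t‖ ^ 2) := by
  rw [hyperplaneReflection_unit_add he ht, inner_sub_right, inner_smul_right, inner_add_right, ht,
    real_inner_self_eq_norm_sq, he, one_pow, add_zero, mul_one]

theorem inner_hyperplaneReflection_unit_add_neg_iff (he : ‖e‖ = 1) (ht : inner ℝ e t = 0) :
    inner ℝ e (hyperplaneReflection (e + t) e) < 0 ↔ ‖t‖ < 1 := by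
  rw [inner_hyperplaneReflection_unit_add he ht, sub_neg, lt_div_iff₀ (by positivity),
    ← sq_lt_one_iff₀ (norm_nonneg t)]
  constructor <;> intro h <;> linarith

theorem hyperplaneReflection_unit_add_injective {t' : F} (he : ‖e‖ = 1) (ht : inner ℝ e t = 0)
    (ht' : inner ℝ e t' = 0)
    (h : hyperplaneReflection (e + t) e = hyperplaneReflection (e + t') e) : t = t' := by
  have hcoeff := congrArg (inner ℝ e) h
  rw [inner_hyperplaneReflection_unit_add he ht, inner_hyperplaneReflection_unit_add he ht',
    sub_right_inj] at hcoeff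
  rw [hyperplaneReflection_unit_add he ht, hyperplaneReflection_unit_add he ht', hcoeff,
    sub_right_inj] at h
  have hne : (2 / (1 + ‖t'‖ ^ 2) : ℝ) ≠ 0 := by positivity
  exact add_left_cancel (smul_right_injective F hne h)

/-- The mirror of `e` and `y` is orthogonal to `e - y`, which is rescaled so that its component
along `e` is `e`. -/
theorem exists_hyperplaneReflection_unit_add_eq {y : F} (he : ‖e‖ = 1) (hy : ‖y‖ = 1)
    (hey : inner ℝ e y < 0) : ∃ t ∈ Submodule.span ℝ {e, y}, inner ℝ e t = 0 ∧ ‖t‖ < 1 ∧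
      hyperplaneReflection (e + t) e = y := by
  have hpos : 0 < 1 - inner ℝ e y := by linarith
  set c : ℝ := (1 - inner ℝ e y)⁻¹
  have horth : inner ℝ e (c • (e - y) - e) = 0 := by
    rw [inner_sub_right, inner_smul_right, inner_sub_right, real_inner_self_eq_norm_sq, he,
      one_pow, inv_mul_cancel₀ hpos.ne', sub_self]
  have hrefl : hyperplaneReflection (e + (c • (e - y) - e)) e = y := by
    rw [add_sub_cancel, hyperplaneReflection_smul (inv_ne_zero hpos.ne')]
    exact Submodule.reflection_sub (he.trans hy.symm)
  have he_mem : e ∈ Submodule.span ℝ {e, y} := Submodule.subset_span (Set.mem_insert e {y})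
  have hy_mem : y ∈ Submodule.span ℝ {e, y} :=
    Submodule.subset_span (Set.mem_insert_of_mem e rfl)
  refine ⟨c • (e - y) - e, Submodule.sub_mem _ (Submodule.smul_mem _ _
    (Submodule.sub_mem _ he_mem hy_mem)) he_mem, horth, ?_, hrefl⟩
  rwa [← inner_hyperplaneReflection_unit_add_neg_iff he horth, hrefl]

end Stereographic

section SchubertFrames

open Finset

variable {p n : ℕ} {F : Type*} [NormedAddCommGroup F] [InnerProductSpace ℝ F]
  {b : OrthonormalBasis (Fin p) ℝ F} {s : Fin n → Fin p}

theorem mem_flag_iff_inner_eq_zero {x : F} {m : Fin (p + 1)} :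
    x ∈ b.toBasis.flag m ↔ ∀ j : Fin p, m ≤ j.castSucc → inner ℝ (b j) x = 0 := by
  rw [Basis.flag, Basis.mem_span_image]
  simp only [Set.subset_def, mem_coe, Finsupp.mem_support_iff, Set.mem_ofPred_eq,
    OrthonormalBasis.coe_toBasis_repr_apply, OrthonormalBasis.repr_apply_apply]
  exact forall_congr' fun j => by rw [not_imp_comm, not_lt]

theorem mem_flag_castSucc_iff {x : F} {k : Fin p} :
    x ∈ b.toBasis.flag k.castSucc ↔ x ∈ b.toBasis.flag k.succ ∧ inner ℝ (b k) x = 0 := by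
  simp only [mem_flag_iff_inner_eq_zero, Fin.castSucc_le_castSucc_iff, Fin.succ_le_castSucc_iff]
  refine ⟨fun h => ⟨fun j hj => h j hj.le, h k le_rfl⟩, fun h j hj => ?_⟩
  rcases hj.eq_or_lt with rfl | hj
  exacts [h.2, h.1 j hj]

theorem exists_unit_inner_neg {W : Submodule ℝ F} {e z : F} (hz : z ∈ W) (h : inner ℝ e z ≠ 0) :
    ∃ y ∈ W, ‖y‖ = 1 ∧ inner ℝ e y < 0 := by
  have hz0 : ‖z‖ ≠ 0 := fun hz0 => h (by rw [norm_eq_zero.1 hz0, inner_zero_right])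
  wlog hneg : inner ℝ e z < 0 generalizing z
  · exact this (W.neg_mem hz) (by simpa using h) (by simpa using hz0)
      (by simpa using (not_lt.1 hneg).lt_of_ne h.symm)
  refine ⟨‖z‖⁻¹ • z, W.smul_mem _ hz, norm_smul_inv_norm (norm_ne_zero_iff.1 hz0), ?_⟩
  rw [inner_smul_right]
  exact mul_neg_of_pos_of_neg (by positivity) hneg

variable (b s) in
/-- An orthonormal frame whose `i`-th vector lies in the flag up to the `s i`-th basis vector and
has a negative component along that vector. For increasing `s`, an `n`-plane of Schubert symbol `s`
contains exactly one such frame. The component is taken negative, not positive, because the mirror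
image of `b (s i)` in its own orthogonal hyperplane is `-b (s i)`. -/
structure IsSchubertFrame (x : Fin n → F) : Prop where
  orthonormal : Orthonormal ℝ x
  mem_flag : ∀ i, x i ∈ b.toBasis.flag (s i).succ
  inner_neg : ∀ i, inner ℝ (b (s i)) (x i) < 0

namespace IsSchubertFrame

variable {x y : Fin n → F}

theorem mem_flag_castSucc (hx : IsSchubertFrame b s x) (hs : StrictMono s) {i j : Fin n}
    (hij : i < j) : x i ∈ b.toBasis.flag (s j).castSucc :=
  b.toBasis.flag_mono (Fin.succ_le_castSucc_iff.2 (hs hij)) (hx.mem_flag i)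

theorem mem_jumps (hx : IsSchubertFrame b s x) {l : Submodule ℝ F} (hl : ∀ i, x i ∈ l)
    (i : Fin n) : s i ∈ jumps b.toBasis l :=
  RepGrassmann.mem_jumps.2 fun h =>
    (hx.inner_neg i).ne (mem_flag_castSucc_iff.1 (h ⟨hl i, hx.mem_flag i⟩)).2

/-- The largest index `k ≥ i` with `⟪x k, z⟫ ≠ 0` would give `z` a nonzero component along
`b (s k)`. -/
theorem inner_eq_zero (hx : IsSchubertFrame b s x) (hs : StrictMono s) {z : F}
    (hz : z ∈ Submodule.span ℝ (Set.range x)) {i : Fin n}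
    (hzi : z ∈ b.toBasis.flag (s i).castSucc) : inner ℝ (x i) z = 0 := by
  obtain ⟨c, rfl⟩ := (Submodule.mem_span_range_iff_exists_fun ℝ).1 hz
  rw [hx.orthonormal.inner_right_fintype]
  by_contra hci
  obtain ⟨k, hk, hmax⟩ := ({k | i ≤ k ∧ c k ≠ 0} : Finset (Fin n)).exists_max_image id
    ⟨i, by simpa using hci⟩
  simp only [mem_filter, mem_univ, true_and, id] at hk hmax
  have hinner : inner ℝ (b (s k)) (∑ j, c j • x j) = c k * inner ℝ (b (s k)) (x k) := by
    rw [inner_sum, sum_eq_single k _ (by simp), inner_smul_right]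
    intro j _ hjk
    rw [inner_smul_right]
    rcases hjk.lt_or_gt with hjk | hkj
    · rw [(mem_flag_castSucc_iff.1 (hx.mem_flag_castSucc hs hjk)).2, mul_zero]
    · rw [not_ne_iff.1 fun hj => hkj.not_ge (hmax j ⟨hk.1.trans hkj.le, hj⟩), zero_mul]
  rw [mem_flag_iff_inner_eq_zero.1 hzi _ (Fin.castSucc_le_castSucc_iff.2 (hs.monotone hk.1))]
    at hinner
  exact mul_ne_zero hk.2 (hx.inner_neg k).ne hinner.symm

/-- The combination of `x i` and `y i` without component along `b (s i)` is orthogonal to both. -/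
theorem eq_of_span_eq (hx : IsSchubertFrame b s x) (hy : IsSchubertFrame b s y)
    (hs : StrictMono s)
    (h : Submodule.span ℝ (Set.range x) = Submodule.span ℝ (Set.range y)) : x = y := by
  funext i
  set α := inner ℝ (b (s i)) (x i)
  set β := inner ℝ (b (s i)) (y i)
  have hα : α < 0 := hx.inner_neg i
  have hβ : β < 0 := hy.inner_neg i
  have hz : β • x i - α • y i ∈ Submodule.span ℝ (Set.range x) :=
    Submodule.sub_mem _ (Submodule.smul_mem _ _ (Submodule.subset_span ⟨i, rfl⟩))
      (Submodule.smul_mem _ _ (h ▸ Submodule.subset_span ⟨i, rfl⟩))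
  have hzi : β • x i - α • y i ∈ b.toBasis.flag (s i).castSucc := mem_flag_castSucc_iff.2
    ⟨Submodule.sub_mem _ (Submodule.smul_mem _ _ (hx.mem_flag i))
      (Submodule.smul_mem _ _ (hy.mem_flag i)), by
        rw [inner_sub_right, inner_smul_right, inner_smul_right, mul_comm, sub_self]⟩
  have heq : β • x i = α • y i := by
    rw [← sub_eq_zero, ← inner_self_eq_zero (𝕜 := ℝ)]
    nth_rw 1 [inner_sub_left]
    rw [inner_smul_left, inner_smul_left, hx.inner_eq_zero hs hz hzi,
      hy.inner_eq_zero hs (h ▸ hz) hzi, mul_zero, mul_zero, sub_zero]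
  have hαβ : α = β := by
    have hnorm := congrArg norm heq
    rw [norm_smul, norm_smul, hx.orthonormal.1, hy.orthonormal.1, mul_one, mul_one,
      Real.norm_of_nonpos hα.le, Real.norm_of_nonpos hβ.le] at hnorm
    exact (neg_injective hnorm).symm
  rw [hαβ] at heq
  exact smul_right_injective F hβ.ne heq

end IsSchubertFrame

theorem exists_unit_mem_orthogonal_of_mem_jumps {l : Submodule ℝ F} {k : Fin p}
    (hk : k ∈ jumps b.toBasis l) : ∃ y ∈ l ⊓ b.toBasis.flag k.succ,
      y ∈ (l ⊓ b.toBasis.flag k.castSucc)ᗮ ∧ ‖y‖ = 1 ∧ inner ℝ (b k) y < 0 := by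
  have := Module.Finite.of_basis b.toBasis
  obtain ⟨v, ⟨hvl, hv⟩, hv'⟩ := SetLike.not_le_iff_exists.1 (mem_jumps.1 hk)
  let W := l ⊓ b.toBasis.flag k.castSucc
  have hW : W ≤ l ⊓ b.toBasis.flag k.succ :=
    inf_le_inf_left l (b.toBasis.flag_mono (Fin.castSucc_lt_succ).le)
  have hproj : W.starProjection v ∈ W := W.starProjection_apply_mem v
  have hinner : inner ℝ (b k) (v - W.starProjection v) ≠ 0 := by
    rw [inner_sub_right, (mem_flag_castSucc_iff.1 hproj.2).2, sub_zero]
    exact fun h => hv' (mem_flag_castSucc_iff.2 ⟨hv, h⟩)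
  obtain ⟨y, ⟨hy, hyW⟩, hy'⟩ := exists_unit_inner_neg (W := (l ⊓ b.toBasis.flag k.succ) ⊓ Wᗮ)
    ⟨Submodule.sub_mem _ ⟨hvl, hv⟩ (hW hproj), W.sub_starProjection_mem_orthogonal v⟩ hinner
  exact ⟨y, hy, hyW, hy'⟩

theorem exists_isSchubertFrame (hs : StrictMono s) {l : Submodule ℝ F} (hl : finrank ℝ l = n)
    (hsl : ∀ i, s i ∈ jumps b.toBasis l) :
    ∃ x, IsSchubertFrame b s x ∧ Submodule.span ℝ (Set.range x) = l := by
  have := Module.Finite.of_basis b.toBasis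
  choose x hx hxW hnorm hneg using fun i => exists_unit_mem_orthogonal_of_mem_jumps (hsl i)
  have horth : ∀ i j, i < j → inner ℝ (x i) (x j) = 0 := fun i j hij => hxW j (x i)
    ⟨(hx i).1, b.toBasis.flag_mono (Fin.succ_le_castSucc_iff.2 (hs hij)) (hx i).2⟩
  have hon : Orthonormal ℝ x := ⟨hnorm, fun i j hij => hij.lt_or_gt.elim (horth i j)
    fun hji => inner_eq_zero_symm.1 (horth j i hji)⟩
  refine ⟨x, ⟨hon, fun i => (hx i).2, hneg⟩, Submodule.eq_of_le_of_finrank_eq ?_ ?_⟩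
  · exact Submodule.span_le.2 (Set.range_subset_iff.2 fun i => (hx i).1)
  · rw [finrank_span_eq_card hon.linearIndependent, Fintype.card_fin, hl]

end SchubertFrames

section Echelon

open Finset

variable {p n : ℕ}

/-- The positions below `s i` which are none of `s 0, …, s (i - 1)`: the `i`-th row of a matrix in
echelon form with pivots `s` is arbitrary there. -/
def freeIndices (s : Fin n → Fin p) (i : Fin n) : Finset (Fin p) :=
  Iio (s i) \ (Iio i).image s

theorem notMem_freeIndices_iff {s : Fin n → Fin p} {i : Fin n} {j : Fin p} :
    j ∉ freeIndices s i ↔ s i ≤ j ∨ ∃ k < i, s k = j := by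
  simp only [freeIndices, mem_sdiff, mem_Iio, mem_image, not_and_or, not_lt, not_not]

theorem freeIndices_comp_castSucc (s : Fin (n + 1) → Fin p) (i : Fin n) :
    freeIndices (s ∘ Fin.castSucc) i = freeIndices s i.castSucc := by
  ext j
  rw [← not_iff_not, notMem_freeIndices_iff, notMem_freeIndices_iff]
  simp [Fin.exists_fin_succ', (Fin.le_last _).not_gt]

variable {F : Type*} [NormedAddCommGroup F] [InnerProductSpace ℝ F]
  (b : OrthonormalBasis (Fin p) ℝ F)

/-- The vectors `b (s i) + t i` are the rows of a matrix in echelon form with pivots `s`. -/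
def IsEchelon (s : Fin n → Fin p) (t : Fin n → F) : Prop :=
  ∀ i, ∀ j ∉ freeIndices s i, inner ℝ (b j) (t i) = 0

/-- The orthonormal frame obtained from the vectors `b (s i)` by reflecting them in the hyperplanes
orthogonal to the rows `b (s j) + t j` of a matrix in echelon form. -/
noncomputable def echelonFrame (s : Fin n → Fin p) (t : Fin n → F) (i : Fin n) : F :=
  reflectionProd (fun j => b (s j) + t j) (b (s i))

variable {b}

namespace IsEchelon

section

variable {s : Fin n → Fin p} {t : Fin n → F}

theorem mem_flag (h : IsEchelon b s t) (i : Fin n) : t i ∈ b.toBasis.flag (s i).castSucc :=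
  mem_flag_iff_inner_eq_zero.2 fun j hj =>
    h i j (notMem_freeIndices_iff.2 (.inl (Fin.castSucc_le_castSucc_iff.1 hj)))

theorem inner_eq_zero (h : IsEchelon b s t) {i k : Fin n} (hki : k ≤ i) :
    inner ℝ (b (s k)) (t i) = 0 := by
  refine h i _ (notMem_freeIndices_iff.2 ?_)
  rcases hki.eq_or_lt with rfl | hki
  exacts [.inl le_rfl, .inr ⟨k, hki, rfl⟩]

theorem add_mem_flag (h : IsEchelon b s t) {i : Fin n} {m : Fin (p + 1)}
    (hm : (s i).castSucc < m) : b (s i) + t i ∈ b.toBasis.flag m :=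
  Submodule.add_mem _ (b.coe_toBasis ▸ b.toBasis.self_mem_flag hm)
    (b.toBasis.flag_mono hm.le (h.mem_flag i))

end

variable {s : Fin (n + 1) → Fin p} {t : Fin (n + 1) → F}

theorem castSucc_iff : (IsEchelon b (s ∘ Fin.castSucc) (t ∘ Fin.castSucc) ∧
    ∀ j ∉ freeIndices s (Fin.last n), inner ℝ (b j) (t (Fin.last n)) = 0) ↔ IsEchelon b s t := by
  simp only [IsEchelon, Fin.forall_fin_succ', freeIndices_comp_castSucc, Function.comp_apply]

theorem comp_castSucc (h : IsEchelon b s t) :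
    IsEchelon b (s ∘ Fin.castSucc) (t ∘ Fin.castSucc) := (castSucc_iff.2 h).1

theorem echelonFrame_comp_castSucc (h : IsEchelon b s t) (hs : StrictMono s) :
    echelonFrame b s t ∘ Fin.castSucc =
      echelonFrame b (s ∘ Fin.castSucc) (t ∘ Fin.castSucc) := by
  funext i
  have horth : inner ℝ (b (s (Fin.last n)) + t (Fin.last n)) (b (s i.castSucc)) = 0 := by
    rw [inner_add_left, b.orthonormal.2 (hs i.castSucc_lt_last).ne', real_inner_comm,
      h.inner_eq_zero i.castSucc_lt_last.le, add_zero]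
  rw [Function.comp_apply, echelonFrame, reflectionProd_succ_apply,
    hyperplaneReflection_of_inner_eq_zero horth]
  rfl

end IsEchelon

variable {s : Fin n → Fin p} {t : Fin n → F}

theorem orthonormal_echelonFrame (hs : StrictMono s) (t : Fin n → F) :
    Orthonormal ℝ (echelonFrame b s t) :=
  (b.orthonormal.comp s hs.injective).comp_linearIsometryEquiv _

namespace IsEchelon

/-- The later reflections fix `b (s i)`, and the earlier ones move vectors only along the flag
below `b (s i)`. -/
theorem echelonFrame_sub_mem_flag (h : IsEchelon b s t) (hs : StrictMono s) (i : Fin n) :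
    echelonFrame b s t i - hyperplaneReflection (b (s i) + t i) (b (s i)) ∈
      b.toBasis.flag (s i).castSucc := by
  induction n with
  | zero => exact i.elim0
  | succ n ih =>
    cases i using Fin.lastCases with
    | cast i =>
      rw [← Function.comp_apply (f := echelonFrame b s t), h.echelonFrame_comp_castSucc hs]
      exact ih h.comp_castSucc (hs.comp Fin.strictMono_castSucc) i
    | last =>
      exact reflectionProd_sub_mem (fun j : Fin n =>
        h.add_mem_flag (Fin.castSucc_lt_castSucc_iff.2 (hs j.castSucc_lt_last))) _

theorem echelonFrame_mem_flag (h : IsEchelon b s t) (hs : StrictMono s) (i : Fin n) :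
    echelonFrame b s t i ∈ b.toBasis.flag (s i).succ := by
  have hb : b (s i) ∈ b.toBasis.flag (s i).succ :=
    b.coe_toBasis ▸ b.toBasis.self_mem_flag (s i).castSucc_lt_succ
  have hrefl := Submodule.add_mem _
    (hyperplaneReflection_sub_mem (h.add_mem_flag (s i).castSucc_lt_succ) (b (s i))) hb
  rw [sub_add_cancel] at hrefl
  simpa using Submodule.add_mem _
    (b.toBasis.flag_mono (s i).castSucc_lt_succ.le (h.echelonFrame_sub_mem_flag hs i)) hrefl

theorem inner_echelonFrame (h : IsEchelon b s t) (hs : StrictMono s) (i : Fin n) :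
    inner ℝ (b (s i)) (echelonFrame b s t i) =
      inner ℝ (b (s i)) (hyperplaneReflection (b (s i) + t i) (b (s i))) := by
  rw [← sub_eq_zero, ← inner_sub_right]
  exact (mem_flag_castSucc_iff.1 (h.echelonFrame_sub_mem_flag hs i)).2

theorem isSchubertFrame_echelonFrame (h : IsEchelon b s t) (hs : StrictMono s)
    (ht : ∀ i, ‖t i‖ < 1) : IsSchubertFrame b s (echelonFrame b s t) where
  orthonormal := orthonormal_echelonFrame hs t
  mem_flag := h.echelonFrame_mem_flag hs
  inner_neg i := by
    rw [h.inner_echelonFrame hs, inner_hyperplaneReflection_unit_add_neg_iff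
      (b.orthonormal.1 _) (h.inner_eq_zero le_rfl)]
    exact ht i

theorem echelonFrame_mem_flag_castSucc (h : IsEchelon b s t) (hs : StrictMono s) {i : Fin n}
    (hi : ‖t i‖ = 1) : echelonFrame b s t i ∈ b.toBasis.flag (s i).castSucc := by
  refine mem_flag_castSucc_iff.2 ⟨h.echelonFrame_mem_flag hs i, ?_⟩
  rw [h.inner_echelonFrame hs, inner_hyperplaneReflection_unit_add (b.orthonormal.1 _)
    (h.inner_eq_zero le_rfl), hi]
  norm_num

theorem eq_of_echelonFrame_eq {t' : Fin n → F} (h : IsEchelon b s t) (h' : IsEchelon b s t')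
    (hs : StrictMono s) (heq : echelonFrame b s t = echelonFrame b s t') : t = t' := by
  induction n with
  | zero => exact Subsingleton.elim t t'
  | succ n ih =>
    have hinit : t ∘ Fin.castSucc = t' ∘ Fin.castSucc := by
      refine ih h.comp_castSucc h'.comp_castSucc (hs.comp Fin.strictMono_castSucc) ?_
      rw [← h.echelonFrame_comp_castSucc hs, heq, h'.echelonFrame_comp_castSucc hs]
    have hlast : t (Fin.last n) = t' (Fin.last n) := by
      have heq_last := congrFun heq (Fin.last n)
      have hrefl : (fun j => b (s j) + t j) ∘ Fin.castSucc =
          (fun j => b (s j) + t' j) ∘ Fin.castSucc :=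
        funext fun j => congrArg (b (s j.castSucc) + ·) (congrFun hinit j)
      simp only [echelonFrame, reflectionProd_succ_apply, hrefl] at heq_last
      exact hyperplaneReflection_unit_add_injective (b.orthonormal.1 _) (h.inner_eq_zero le_rfl)
        (h'.inner_eq_zero le_rfl) (LinearIsometryEquiv.injective _ heq_last)
    exact funext (Fin.lastCases hlast (congrFun hinit))

end IsEchelon

theorem IsSchubertFrame.comp_castSucc {s : Fin (n + 1) → Fin p} {x : Fin (n + 1) → F}
    (hx : IsSchubertFrame b s x) : IsSchubertFrame b (s ∘ Fin.castSucc) (x ∘ Fin.castSucc) where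
  orthonormal := hx.orthonormal.comp _ (Fin.castSucc_injective n)
  mem_flag i := hx.mem_flag i.castSucc
  inner_neg i := hx.inner_neg i.castSucc

/-- The last row is found by applying the inverses of the earlier reflections to the last vector
`x` of the frame: the result `y` is a mirror image of the last `b (s i)`. -/
theorem exists_last_row {s : Fin (n + 1) → Fin p} (hs : StrictMono s) {t : Fin n → F}
    (h : IsEchelon b (s ∘ Fin.castSucc) t) {x : F} (hx : ‖x‖ = 1)
    (hxs : x ∈ b.toBasis.flag (s (Fin.last n)).succ) (hneg : inner ℝ (b (s (Fin.last n))) x < 0)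
    (horth : ∀ i, inner ℝ (echelonFrame b (s ∘ Fin.castSucc) t i) x = 0) :
    ∃ r : F, (∀ j ∉ freeIndices s (Fin.last n), inner ℝ (b j) r = 0) ∧ ‖r‖ < 1 ∧
      reflectionProd (fun j => b (s j.castSucc) + t j)
        (hyperplaneReflection (b (s (Fin.last n)) + r) (b (s (Fin.last n)))) = x := by
  set e := b (s (Fin.last n))
  set R := reflectionProd fun j => b (s j.castSucc) + t j
  obtain ⟨y, rfl⟩ := R.surjective x
  have hsub : R y - y ∈ b.toBasis.flag (s (Fin.last n)).castSucc := reflectionProd_sub_mem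
    (fun j => h.add_mem_flag (Fin.castSucc_lt_castSucc_iff.2 (hs j.castSucc_lt_last))) y
  have hinner : ∀ j, s (Fin.last n) ≤ j → inner ℝ (b j) y = inner ℝ (b j) (R y) := fun j hj => by
    rw [eq_comm, ← sub_eq_zero, ← inner_sub_right]
    exact mem_flag_iff_inner_eq_zero.1 hsub j (Fin.castSucc_le_castSucc_iff.2 hj)
  obtain ⟨r, hr, her, hr1, hrefl⟩ := exists_hyperplaneReflection_unit_add_eq
    (b.orthonormal.1 (s (Fin.last n))) ((R.norm_map y).symm.trans hx)
    ((hinner _ le_rfl).trans_lt hneg)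
  refine ⟨r, fun j hj => ?_, hr1, congrArg R hrefl⟩
  rcases eq_or_ne j (s (Fin.last n)) with rfl | hjs
  · exact her
  have hjy : inner ℝ (b j) y = 0 := by
    rcases notMem_freeIndices_iff.1 hj with hj | ⟨k, hk, rfl⟩
    · rw [hinner j hj]
      exact mem_flag_iff_inner_eq_zero.1 hxs j (Fin.succ_le_castSucc_iff.2 (hj.lt_of_ne' hjs))
    · obtain ⟨k, rfl⟩ := Fin.exists_castSucc_eq.2 hk.ne
      rw [← R.inner_map_map]
      exact horth k
  have hspan : Submodule.span ℝ {e, y} ≤ LinearMap.ker (innerₗ F (b j)) := Submodule.span_le.2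
    (Set.insert_subset (b.orthonormal.2 hjs) (Set.singleton_subset_iff.2 hjy))
  exact hspan hr

theorem IsSchubertFrame.exists_isEchelon {x : Fin n → F} (hx : IsSchubertFrame b s x)
    (hs : StrictMono s) : ∃ t, IsEchelon b s t ∧ (∀ i, ‖t i‖ < 1) ∧ echelonFrame b s t = x := by
  induction n with
  | zero => exact ⟨0, fun i => i.elim0, fun i => i.elim0, Subsingleton.elim _ _⟩
  | succ n ih =>
    obtain ⟨t, ht, ht1, htx⟩ := ih hx.comp_castSucc (hs.comp Fin.strictMono_castSucc)
    obtain ⟨r, hr, hr1, hrx⟩ := exists_last_row hs ht (hx.orthonormal.1 _) (hx.mem_flag _)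
      (hx.inner_neg _) fun i => htx ▸ hx.orthonormal.2 i.castSucc_lt_last.ne
    have hinit : (Fin.snoc t r : Fin (n + 1) → F) ∘ Fin.castSucc = t :=
      funext fun i => Fin.snoc_castSucc ..
    have h : IsEchelon b s (Fin.snoc t r) := IsEchelon.castSucc_iff.1
      ⟨hinit.symm ▸ ht, by rwa [Fin.snoc_last]⟩
    refine ⟨Fin.snoc t r, h, Fin.lastCases (by rwa [Fin.snoc_last])
      fun i => by rw [Fin.snoc_castSucc]; exact ht1 i, funext (Fin.lastCases ?_ (congrFun ?_))⟩
    · rw [← hrx, echelonFrame, reflectionProd_succ_apply]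
      simp [Function.comp_def]
    · change echelonFrame b s (Fin.snoc t r) ∘ Fin.castSucc = x ∘ Fin.castSucc
      rw [h.echelonFrame_comp_castSucc hs, hinit, htx]

end Echelon

section Topology

open Set Topology

section Grassmannian

variable {n p : ℕ}

theorem continuous_frame_apply (i : Fin n) : Continuous fun v : Frame n p => v.1 i :=
  (continuous_apply i).comp continuous_subtype_val

theorem continuous_toGrassmannian :
    Continuous (Frame.toGrassmannian : Frame n p → Grassmannian n p) :=
  continuous_coinduced_rng

theorem toGrassmannian_surjective :
    Function.Surjective (Frame.toGrassmannian : Frame n p → Grassmannian n p) := by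
  rintro ⟨l, rfl⟩
  have b := finBasis ℝ l
  refine ⟨⟨fun i => b i, b.linearIndependent.map' l.subtype l.ker_subtype⟩, Subtype.ext ?_⟩
  change Submodule.span ℝ (range (l.subtype ∘ b)) = l
  rw [range_comp, Submodule.span_image, b.span_eq, Submodule.map_subtype_top]

theorem toGrassmannian_eq_iff {v : Frame n p} {l : Grassmannian n p} :
    v.toGrassmannian = l ↔ ∀ i, v.1 i ∈ l.1 := by
  refine ⟨fun h i => h ▸ Submodule.subset_span (mem_range_self i), fun h => Subtype.ext ?_⟩
  exact Submodule.eq_of_le_of_finrank_eq (Submodule.span_le.2 (range_subset_iff.2 h))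
    (v.toGrassmannian.2.trans l.2.symm)

/-- The saturation of an open set of frames is the union of its preimages under the changes of
basis. -/
theorem isOpenMap_toGrassmannian :
    IsOpenMap (Frame.toGrassmannian : Frame n p → Grassmannian n p) := by
  intro U hU
  let changeBasis (A : Matrix (Fin n) (Fin n) ℝ) (v : Frame n p) (i : Fin n) : E p :=
    ∑ j, A i j • v.1 j
  have hsat : Frame.toGrassmannian ⁻¹' (Frame.toGrassmannian '' U) =
      ⋃ A, changeBasis A ⁻¹' (Subtype.val '' U) := by
    ext w
    simp only [mem_preimage, mem_image, mem_iUnion, toGrassmannian_eq_iff]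
    constructor
    · rintro ⟨v, hv, hvw⟩
      choose A hA using fun i => Submodule.mem_span_range_iff_exists_fun ℝ |>.1 (hvw i)
      exact ⟨A, v, hv, funext fun i => (hA i).symm⟩
    · rintro ⟨A, v, hv, hvA⟩
      refine ⟨v, hv, fun i => hvA ▸ Submodule.sum_mem _ fun j _ => Submodule.smul_mem _ _ ?_⟩
      exact Submodule.subset_span (mem_range_self j)
  have hU' := isOpen_setOfPred_linearIndependent.isOpenMap_subtype_val U hU
  refine isOpen_coinduced.2 ?_
  rw [hsat]
  exact isOpen_iUnion fun A => hU'.preimage <| continuous_pi fun i =>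
    continuous_finsetSum _ fun j _ => (continuous_frame_apply j).const_smul (A i j)

theorem isOpenQuotientMap_toGrassmannian :
    IsOpenQuotientMap (Frame.toGrassmannian : Frame n p → Grassmannian n p) :=
  ⟨toGrassmannian_surjective, continuous_toGrassmannian, isOpenMap_toGrassmannian⟩

/-- Two frames `v` and `w` span different planes if and only if some `v i` is linearly independent
of `w`, which is an open condition. -/
instance : T2Space (Grassmannian n p) := by
  refine (t2Space_iff_of_isOpenQuotientMap isOpenQuotientMap_toGrassmannian).2 ?_
  have hcompl : {x : Frame n p × Frame n p | x.1.toGrassmannian = x.2.toGrassmannian}ᶜ =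
      ⋃ i, (fun x => Fin.cons (x.1.1 i) x.2.1) ⁻¹' {v : Fin (n + 1) → E p |
        LinearIndependent ℝ v} := by
    ext ⟨v, w⟩
    simp only [mem_compl_iff, mem_ofPred_eq, mem_iUnion, mem_preimage,
      linearIndependent_finCons, w.2, true_and, toGrassmannian_eq_iff, not_forall]
    rfl
  rw [← isOpen_compl_iff, hcompl]
  exact isOpen_iUnion fun i => isOpen_setOfPred_linearIndependent.preimage
    (((continuous_frame_apply i).comp continuous_fst).finCons
      (continuous_subtype_val.comp continuous_snd))

end Grassmannian

theorem isEmbedding_domRestrict_of_isCompact {X Y : Type*} [TopologicalSpace X]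
    [TopologicalSpace Y] [T2Space Y] {f : X → Y} {s K : Set X} (hK : IsCompact K) (hs : s ⊆ K)
    (hf : ContinuousOn f K) (hinj : ∀ x ∈ s, ∀ y ∈ K, f y = f x → y = x) :
    IsEmbedding (s.domRestrict f) := by
  have := isCompact_iff_compactSpace.1 hK
  have hfK := continuousOn_iff_continuous_domRestrict.1 hf
  refine ⟨isInducing_iff_nhds.2 fun x => ?_, fun x y h => Subtype.ext ?_⟩
  · have hfiber : K.domRestrict f ⁻¹' {f x} = {inclusion hs x} := by
      ext y
      refine ⟨fun hy => Subtype.ext (hinj x x.2 y y.2 hy), ?_⟩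
      rintro rfl
      rfl
    have hnhds := hfK.isClosedMap.comap_nhds_eq hfK (f x)
    rw [hfiber, nhdsSet_singleton] at hnhds
    rw [(IsEmbedding.inclusion hs).isInducing.nhds_eq_comap, ← hnhds, Filter.comap_comap]
    rfl
  · exact hinj y y.2 x (hs x.2) h

section RadialRescaling

open Metric

variable {F G : Type*} [NormedAddCommGroup F] [NormedSpace ℝ F] [NormedAddCommGroup G]
  [NormedSpace ℝ G]

theorem gauge_preimage_unit_ball (T : F →ₗ[ℝ] G) (x : F) :
    gauge (T ⁻¹' ball 0 1) x = ‖T x‖ := by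
  rw [← gauge_unit_ball (T x)]
  simp only [gauge_def', mem_preimage, map_smul]

variable [FiniteDimensional ℝ F]

theorem isVonNBounded_preimage_unit_ball {T : F →ₗ[ℝ] G} (hT : Function.Injective T) :
    Bornology.IsVonNBounded ℝ (T ⁻¹' ball 0 1) := by
  obtain ⟨K, -, hK⟩ := T.exists_antilipschitzWith (LinearMap.ker_eq_bot.2 hT)
  exact (NormedSpace.isVonNBounded_iff ℝ).2 (hK.isBounded_preimage isBounded_ball)

theorem preimage_unit_ball_mem_nhds (T : F →ₗ[ℝ] G) : T ⁻¹' ball 0 1 ∈ 𝓝 0 :=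
  T.continuous_of_finiteDimensional.continuousAt.preimage_mem_nhds
    ((map_zero T).symm ▸ ball_mem_nhds 0 one_pos)

/-- The radial homeomorphism `x ↦ (‖x‖ / ‖T x‖) • x`, which carries the unit ball of `F` to the
unit ball of the norm induced by an injective linear map `T`. -/
noncomputable def radialRescaling (T : F →ₗ[ℝ] G) (hT : Function.Injective T) : F ≃ₜ F :=
  gaugeRescaleHomeomorph (ball 0 1) (T ⁻¹' ball 0 1) (convex_ball 0 1) (ball_mem_nhds 0 one_pos)
    (NormedSpace.isVonNBounded_ball ℝ F 1) ((convex_ball 0 1).linear_preimage T)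
    (preimage_unit_ball_mem_nhds T) (isVonNBounded_preimage_unit_ball hT)

variable {T : F →ₗ[ℝ] G} (hT : Function.Injective T)

theorem radialRescaling_apply (x : F) : radialRescaling T hT x = (‖x‖ / ‖T x‖) • x := by
  change gaugeRescale (ball 0 1) (T ⁻¹' ball 0 1) x = _
  rw [gaugeRescale_def, gauge_unit_ball, gauge_preimage_unit_ball]

theorem norm_map_radialRescaling (x : F) : ‖T (radialRescaling T hT x)‖ = ‖x‖ := by
  rcases eq_or_ne x 0 with rfl | hx
  · simp [radialRescaling_apply]
  · have hTx : ‖T x‖ ≠ 0 := norm_ne_zero_iff.2 ((map_ne_zero_iff T hT).2 hx)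
    rw [radialRescaling_apply, map_smul, norm_smul, norm_div, norm_norm, norm_norm,
      div_mul_cancel₀ _ hTx]

theorem radialRescaling_map {g : F →ₗ[ℝ] F} (hg : ∀ x, ‖g x‖ = ‖x‖)
    (hTg : ∀ x, ‖T (g x)‖ = ‖T x‖) (x : F) :
    radialRescaling T hT (g x) = g (radialRescaling T hT x) := by
  rw [radialRescaling_apply, radialRescaling_apply, hg, hTg, map_smul]

end RadialRescaling

end Topology

section FreeEntries

open Finset

theorem FlagSymbol.sign_eq_sign_iff {p q : ℕ} (φ : FlagSymbol p q) (j k : Fin p) :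
    φ.sign j = φ.sign k ↔ ((j : ℕ) + 1 ∈ φ.entries ↔ (k : ℕ) + 1 ∈ φ.entries) := by
  unfold sign
  split_ifs with hj hk hk <;> simp only [hj, hk] <;> norm_num

theorem card_freeIndices {n p : ℕ} {s : Fin n → Fin p} (hs : StrictMono s) (i : Fin n) :
    #(freeIndices s i) = s i - i := by
  rw [freeIndices, card_sdiff_of_subset, card_image_of_injective _ hs.injective, Fin.card_Iio,
    Fin.card_Iio]
  exact image_subset_iff.2 fun k hk => mem_Iio.2 (hs (mem_Iio.1 hk))

/-- The free entries of the matrices in echelon form with pivots `s`. -/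
abbrev FreeEntry {n p : ℕ} (s : Fin n → Fin p) : Type :=
  (i : Fin n) × {j // j ∈ freeIndices s i}

/-- The generator of `ℤ/2` acts by `-1` on the given entry of the matrices in echelon form with
pivots `s`: it acts by different signs on the basis vectors of the column and of the pivot. -/
abbrev FreeEntry.IsTwisted {n p q : ℕ} {s : Fin n → Fin p} (φ : FlagSymbol p q)
    (x : FreeEntry s) : Prop :=
  φ.sign x.2 ≠ φ.sign (s x.1)

namespace SchubertSymbol

variable {n p q : ℕ} (σ : SchubertSymbol n p) (φ : FlagSymbol p q)

theorem image_add_one_freeIndices (i : Fin n) :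
    (freeIndices σ.index i).image (fun j : Fin p => (j : ℕ) + 1) =
      Icc 1 (σ.seq i) \ σ.initial i := by
  ext m
  simp only [freeIndices, initial, ← index_add_one, mem_image, mem_sdiff, mem_Iio, mem_Iic, mem_Icc,
    not_exists, not_and]
  constructor
  · rintro ⟨j, ⟨hj, hjs⟩, rfl⟩
    refine ⟨⟨Nat.le_add_left 1 j, Nat.succ_le_succ (Fin.le_def.1 hj.le)⟩, fun k hk hkj => ?_⟩
    obtain rfl := Fin.ext (Nat.succ_injective hkj)
    rcases hk.eq_or_lt with rfl | hk
    exacts [hj.false, hjs k hk rfl]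
  · rintro ⟨⟨hm, hmi⟩, hms⟩
    obtain ⟨j, rfl⟩ := Nat.exists_eq_add_of_le' hm
    have hji : j < σ.index i :=
      lt_of_le_of_ne (Nat.le_of_succ_le_succ hmi) fun h => hms i le_rfl (congrArg (· + 1) h.symm)
    exact ⟨⟨j, hji.trans (σ.index i).2⟩,
      ⟨hji, fun k hk hkj => hms k hk.le (congrArg (fun c : Fin p => (c : ℕ) + 1) hkj)⟩, rfl⟩

theorem card_filter_freeIndices (i : Fin n) (P : ℕ → Prop) [DecidablePred P] :
    #{j ∈ freeIndices σ.index i | P ((j : Fin p) + 1)} =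
      #{m ∈ Icc 1 (σ.seq i) \ σ.initial i | P m} := by
  rw [← image_add_one_freeIndices, filter_image,
    card_image_of_injective _ fun j k h => Fin.ext (Nat.succ_injective h)]

theorem card_freeEntry : Fintype.card (FreeEntry σ.index) = σ.dim := by
  rw [Fintype.card_sigma, dim_eq_sum]
  simp only [Fintype.card_coe, card_freeIndices σ.index_strictMono]

theorem card_filter_isTwisted :
    #{x : FreeEntry σ.index | x.IsTwisted φ} = σ.twists φ := by
  have hrow (i : Fin n) : #{j ∈ freeIndices σ.index i | φ.sign j ≠ φ.sign (σ.index i)} =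
      #{m ∈ Icc 1 (σ.seq i) \ σ.initial i | ¬ (m ∈ φ.entries ↔ σ.seq i ∈ φ.entries)} := by
    simp only [← card_filter_freeIndices, ne_eq, φ.sign_eq_sign_iff, index_add_one]
  have hsigma : #{x : FreeEntry σ.index | x.IsTwisted φ} =
      ∑ i, #{j ∈ freeIndices σ.index i | φ.sign j ≠ φ.sign (σ.index i)} := by
    rw [card_filter, Fintype.sum_sigma]
    refine sum_congr rfl fun i _ => ?_
    rw [card_filter]
    exact sum_coe_sort _ fun j => if φ.sign j ≠ φ.sign (σ.index i) then 1 else 0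
  rw [hsigma, twists, sum_filter, sum_filter, ← sum_add_distrib]
  refine sum_congr rfl fun i _ => ?_
  rw [hrow]
  split_ifs with hi
  · rw [add_zero]
    congr 1
    grind
  · rw [zero_add]
    congr 1
    grind

theorem twists_le_dim : σ.twists φ ≤ σ.dim := by
  rw [← card_filter_isTwisted, ← card_freeEntry]
  exact card_filter_le _ _

end SchubertSymbol

theorem exists_equiv_fin_add_lt_iff {α : Type*} [Fintype α] (P : α → Prop) [DecidablePred P]
    {a b : ℕ} (ha : Fintype.card α = a) (hb : #{x | P x} = b) :
    ∃ e : Fin a ≃ α, ∀ k : Fin a, (k : ℕ) + b < a ↔ ¬ P (e k) := by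
  let e₀ := (Fintype.equivFinOfCardEq ha).symm
  have hcard : #{k : Fin a | (k : ℕ) + b < a} = #{k | ¬ P (e₀ k)} := by
    have hP : #{k | P (e₀ k)} = b := by
      rw [← hb]
      exact card_equiv e₀ (by simp)
    have hnot := card_filter_add_card_filter_not (s := univ) fun k => P (e₀ k)
    simp only [← Nat.lt_sub_iff_add_lt, Fin.card_filter_val_lt]
    grind [card_fin]
  rw [← Fintype.card_subtype, ← Fintype.card_subtype] at hcard
  let e := Fintype.equivOfCardEq hcard
  exact ⟨e.extendSubtype.trans e₀, fun k =>
    ⟨e.extendSubtype_mem k, not_imp_not.1 (e.extendSubtype_not_mem k)⟩⟩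

end FreeEntries

section EchelonRows

variable {n p a : ℕ} {s : Fin n → Fin p} {F : Type*} [NormedAddCommGroup F]
  [InnerProductSpace ℝ F] (b : OrthonormalBasis (Fin p) ℝ F) (e : Fin a ≃ FreeEntry s)

/-- The rows, without their pivots, of the matrix in echelon form with given free entries; `e`
numbers the free entries. -/
noncomputable def echelonRows : E a →ₗ[ℝ] (Fin n → F) where
  toFun x i := ∑ j : {j // j ∈ freeIndices s i}, x (e.symm ⟨i, j⟩) • b j
  map_add' x y := funext fun i => by
    simp only [PiLp.add_apply, add_smul, Finset.sum_add_distrib, Pi.add_apply]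
  map_smul' c x := funext fun i => by
    simp only [PiLp.smul_apply, smul_eq_mul, mul_smul, Finset.smul_sum, Pi.smul_apply,
      RingHom.id_apply]

theorem echelonRows_apply (x : E a) (i : Fin n) :
    echelonRows b e x i = ∑ j : {j // j ∈ freeIndices s i}, x (e.symm ⟨i, j⟩) • b j := rfl

theorem inner_echelonRows (x : E a) (i : Fin n) (j : {j // j ∈ freeIndices s i}) :
    inner ℝ (b j) (echelonRows b e x i) = x (e.symm ⟨i, j⟩) :=
  (b.orthonormal.comp _ Subtype.val_injective).inner_right_fintype
    (fun j : {j // j ∈ freeIndices s i} => x (e.symm ⟨i, j⟩)) j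

theorem isEchelon_echelonRows (x : E a) : IsEchelon b s (echelonRows b e x) := by
  intro i j hj
  rw [echelonRows_apply, inner_sum]
  refine Finset.sum_eq_zero fun k _ => ?_
  rw [inner_smul_right, b.orthonormal.2 (ne_of_mem_of_not_mem k.2 hj).symm, mul_zero]

theorem echelonRows_injective : Function.Injective (echelonRows b e) := by
  intro x y h
  ext k
  obtain ⟨⟨i, j⟩, rfl⟩ := e.symm.surjective k
  rw [← inner_echelonRows b e, h, inner_echelonRows]

variable {b} in
theorem IsEchelon.exists_echelonRows_eq {t : Fin n → F} (ht : IsEchelon b s t) :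
    ∃ x, echelonRows b e x = t := by
  let entry (k : FreeEntry s) : ℝ := inner ℝ (b k.2) (t k.1)
  refine ⟨WithLp.toLp 2 (entry ∘ e), funext fun i => b.repr.injective <| PiLp.ext fun j => ?_⟩
  rw [b.repr_apply_apply, b.repr_apply_apply]
  by_cases hj : j ∈ freeIndices s i
  · rw [inner_echelonRows b e _ i ⟨j, hj⟩]
    exact congrArg entry (e.apply_symm_apply _)
  · rw [isEchelon_echelonRows b e _ i j hj, ht i j hj]

/-- `echelonRows` precomposed with a radial rescaling of the disk, so that the norm of a point of
the disk is the maximum of the norms of its rows. -/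
noncomputable def diskRows (x : E a) : Fin n → F :=
  echelonRows b e (radialRescaling (echelonRows b e) (echelonRows_injective b e) x)

theorem continuous_diskRows : Continuous (diskRows b e) :=
  (echelonRows b e).continuous_of_finiteDimensional.comp (Homeomorph.continuous _)

theorem isEchelon_diskRows (x : E a) : IsEchelon b s (diskRows b e x) :=
  isEchelon_echelonRows b e _

theorem norm_diskRows (x : E a) : ‖diskRows b e x‖ = ‖x‖ :=
  norm_map_radialRescaling _ x

theorem diskRows_injective : Function.Injective (diskRows b e) :=
  (echelonRows_injective b e).comp (Homeomorph.injective _)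

variable {b} in
theorem IsEchelon.exists_diskRows_eq {t : Fin n → F} (ht : IsEchelon b s t) :
    ∃ x, diskRows b e x = t := by
  obtain ⟨x, hx⟩ := ht.exists_echelonRows_eq e
  refine ⟨(radialRescaling _ (echelonRows_injective b e)).symm x, ?_⟩
  rw [diskRows, Homeomorph.apply_symm_apply, hx]

end EchelonRows

section Action

/-- The action of the generator of `ℤ/2` on `ℝ^{p,q}` as a linear isometry. -/
noncomputable def actIsometry (p q : ℕ) : E p →ₗᵢ[ℝ] E p where
  toLinearMap := (act p q).toLinearMap
  norm_map' x := by
    rw [EuclideanSpace.norm_eq, EuclideanSpace.norm_eq]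
    refine congrArg Real.sqrt (Finset.sum_congr rfl fun k _ => ?_)
    change ‖sgn p q k * x k‖ ^ 2 = _
    rw [norm_mul, mul_pow, Real.norm_eq_abs, sq_abs, sq, sgn_mul_self, one_mul]

variable {n p q a c : ℕ} {s : Fin n → Fin p} {φ : FlagSymbol p q}
  {b : OrthonormalBasis (Fin p) ℝ (E p)} {e : Fin a ≃ FreeEntry s}

theorem FreeEntry.sgn_eq_sign_mul_sign (he : ∀ k : Fin a, k + c < a ↔ ¬ (e k).IsTwisted φ)
    (k : Fin a) : sgn a c k = φ.sign (e k).2 * φ.sign (s (e k).1) := by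
  have hk := he k
  unfold sgn
  unfold FreeEntry.IsTwisted FlagSymbol.sign at hk
  unfold FlagSymbol.sign
  grind

theorem echelonRows_act (hb : ∀ j, act p q (b j) = φ.sign j • b j)
    (he : ∀ k : Fin a, k + c < a ↔ ¬ (e k).IsTwisted φ) (x : E a) (i : Fin n) :
    echelonRows b e (act a c x) i = φ.sign (s i) • act p q (echelonRows b e x i) := by
  rw [echelonRows_apply, echelonRows_apply, map_sum, Finset.smul_sum]
  refine Finset.sum_congr rfl fun j _ => ?_
  have hsgn := FreeEntry.sgn_eq_sign_mul_sign he (e.symm ⟨i, j⟩)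
  rw [e.apply_symm_apply] at hsgn
  change (sgn a c (e.symm ⟨i, j⟩) * x (e.symm ⟨i, j⟩)) • b j = _
  rw [hsgn, map_smul, hb, smul_smul, smul_smul]
  congr 1
  ring

theorem diskRows_act (hb : ∀ j, act p q (b j) = φ.sign j • b j)
    (he : ∀ k : Fin a, k + c < a ↔ ¬ (e k).IsTwisted φ) (x : E a) (i : Fin n) :
    diskRows b e (act a c x) i = φ.sign (s i) • act p q (diskRows b e x i) := by
  have hnorm (x : E a) : ‖echelonRows b e (act a c x)‖ = ‖echelonRows b e x‖ := by
    simp only [Pi.norm_def]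
    congr! 3 with i
    have hsign : ‖φ.sign (s i)‖₊ = 1 := by
      unfold FlagSymbol.sign
      split_ifs <;> simp
    rw [echelonRows_act hb he, nnnorm_smul, hsign, one_mul]
    exact (actIsometry p q).nnnorm_map _
  have hrescale : radialRescaling _ (echelonRows_injective b e) (act a c x) =
      act a c (radialRescaling _ (echelonRows_injective b e) x) :=
    radialRescaling_map (g := (act a c).toLinearMap) _ (actIsometry a c).norm_map hnorm x
  rw [diskRows, hrescale]
  exact echelonRows_act hb he _ i

end Action

section EchelonPlane

variable {n p : ℕ} (b : OrthonormalBasis (Fin p) ℝ (E p)) (σ : SchubertSymbol n p)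

/-- The plane spanned by the orthonormal frame `echelonFrame b σ.index t`. -/
noncomputable def echelonPlane (t : Fin n → E p) : Grassmannian n p :=
  Frame.toGrassmannian
    ⟨echelonFrame b σ.index t, (orthonormal_echelonFrame σ.index_strictMono t).linearIndependent⟩

variable {b σ} {t : Fin n → E p}

theorem echelonFrame_mem_echelonPlane (i : Fin n) :
    echelonFrame b σ.index t i ∈ (echelonPlane b σ t).1 :=
  Submodule.subset_span (Set.mem_range_self i)

theorem continuous_echelonPlane {X : Type*} [TopologicalSpace X] {t : X → Fin n → E p}
    (ht : Continuous t) (h : ∀ x, IsEchelon b σ.index (t x)) :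
    Continuous fun x => echelonPlane b σ (t x) := by
  refine continuous_toGrassmannian.comp (Continuous.subtype_mk (continuous_pi fun i => ?_) _)
  refine continuous_reflectionProd (by fun_prop) (fun x i h0 => ?_) continuous_const
  have hpivot := congrArg (inner ℝ (b (σ.index i))) h0
  rw [inner_add_right, (h x).inner_eq_zero le_rfl, inner_zero_right, add_zero,
    real_inner_self_eq_norm_sq, b.orthonormal.1] at hpivot
  norm_num at hpivot

theorem echelonPlane_act {q : ℕ} {φ : FlagSymbol p q}
    (hb : ∀ j, act p q (b j) = φ.sign j • b j) {t' : Fin n → E p}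
    (ht : ∀ i, t' i = φ.sign (σ.index i) • act p q (t i)) :
    echelonPlane b σ t' = (echelonPlane b σ t).act q := by
  have hsign (j : Fin p) : φ.sign j ≠ 0 := left_ne_zero_of_mul_eq_one (φ.sign_mul_self j)
  have hb' (j : Fin p) : b j = φ.sign j • actIsometry p q (b j) := by
    change b j = φ.sign j • act p q (b j)
    rw [hb, smul_smul, φ.sign_mul_self, one_smul]
  have hrows : (fun i => b (σ.index i) + t' i) =
      fun i => φ.sign (σ.index i) • (actIsometry p q ∘ fun i => b (σ.index i) + t i) i := by
    funext i
    rw [Function.comp_apply, map_add, smul_add, ← hb', ht]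
    rfl
  refine toGrassmannian_eq_iff.2 fun i => ?_
  have hframe : echelonFrame b σ.index t' i =
      φ.sign (σ.index i) • actIsometry p q (echelonFrame b σ.index t i) := by
    rw [echelonFrame, hrows, reflectionProd_smul fun i => hsign _, hb' (σ.index i), map_smul,
      reflectionProd_map]
    rfl
  change echelonFrame b σ.index t' i ∈ _
  rw [hframe]
  exact Submodule.smul_mem _ _ ⟨_, echelonFrame_mem_echelonPlane i, rfl⟩

theorem schubertSymbol_echelonPlane (h : IsEchelon b σ.index t) (ht : ∀ i, ‖t i‖ < 1) :
    (echelonPlane b σ t).schubertSymbol b.toBasis = σ :=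
  SchubertSymbol.index_injective <|
    (Grassmannian.index_schubertSymbol_eq_iff _ _ σ.index_strictMono).2 <|
      (h.isSchubertFrame_echelonFrame σ.index_strictMono ht).mem_jumps echelonFrame_mem_echelonPlane

theorem dim_schubertSymbol_echelonPlane_lt (h : IsEchelon b σ.index t) {i : Fin n}
    (hi : ‖t i‖ = 1) : ((echelonPlane b σ t).schubertSymbol b.toBasis).dim < σ.dim :=
  Grassmannian.dim_schubertSymbol_lt
    (orthonormal_echelonFrame σ.index_strictMono t).linearIndependent
    echelonFrame_mem_echelonPlane (h.echelonFrame_mem_flag σ.index_strictMono)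
    (h.echelonFrame_mem_flag_castSucc σ.index_strictMono hi)

theorem eq_of_echelonPlane_eq {t' : Fin n → E p} (h : IsEchelon b σ.index t)
    (h' : IsEchelon b σ.index t') (ht : ∀ i, ‖t i‖ < 1) (ht' : ∀ i, ‖t' i‖ < 1)
    (heq : echelonPlane b σ t = echelonPlane b σ t') : t = t' :=
  have hs := σ.index_strictMono
  h.eq_of_echelonFrame_eq h' hs <| (h.isSchubertFrame_echelonFrame hs ht).eq_of_span_eq
    (h'.isSchubertFrame_echelonFrame hs ht') hs (congrArg Subtype.val heq)

theorem exists_echelonPlane_eq {l : Grassmannian n p} (hl : l.schubertSymbol b.toBasis = σ) :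
    ∃ t, IsEchelon b σ.index t ∧ (∀ i, ‖t i‖ < 1) ∧ echelonPlane b σ t = l := by
  have hs := σ.index_strictMono
  obtain ⟨x, hx, hxl⟩ := exists_isSchubertFrame hs l.2
    ((l.index_schubertSymbol_eq_iff _ hs).1 (congrArg SchubertSymbol.index hl))
  obtain ⟨t, h, ht, rfl⟩ := hx.exists_isEchelon hs
  exact ⟨t, h, ht, Subtype.ext hxl⟩

end EchelonPlane

section CharacteristicMap

variable {n p a : ℕ} {σ : SchubertSymbol n p} (b : OrthonormalBasis (Fin p) ℝ (E p))
  (e : Fin a ≃ FreeEntry σ.index)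

/-- The characteristic map of the Schubert cell of `σ` for the flag of `b`; `e` numbers the
coordinates of the disk. -/
noncomputable def characteristicMap (x : E a) : Grassmannian n p :=
  echelonPlane b σ (diskRows b e x)

theorem continuous_characteristicMap : Continuous (characteristicMap b e) :=
  continuous_echelonPlane (continuous_diskRows b e) (isEchelon_diskRows b e)

variable {b e}

theorem characteristicMap_act {q c : ℕ} {φ : FlagSymbol p q}
    (hb : ∀ j, act p q (b j) = φ.sign j • b j)
    (he : ∀ k : Fin a, k + c < a ↔ ¬ (e k).IsTwisted φ) (x : E a) :
    characteristicMap b e (act a c x) = (characteristicMap b e x).act q :=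
  echelonPlane_act hb (diskRows_act hb he x)

theorem norm_diskRows_lt_one_iff {x : E a} : (∀ i, ‖diskRows b e x i‖ < 1) ↔ ‖x‖ < 1 := by
  rw [← norm_diskRows b e, pi_norm_lt_iff one_pos]

theorem schubertSymbol_characteristicMap {x : E a} (hx : ‖x‖ < 1) :
    (characteristicMap b e x).schubertSymbol b.toBasis = σ :=
  schubertSymbol_echelonPlane (isEchelon_diskRows b e x) (norm_diskRows_lt_one_iff.2 hx)

theorem dim_schubertSymbol_characteristicMap_lt {x : E a} (hx : ‖x‖ = 1) :
    ((characteristicMap b e x).schubertSymbol b.toBasis).dim < σ.dim := by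
  obtain ⟨i, hi⟩ : ∃ i, 1 ≤ ‖diskRows b e x i‖ := by
    simpa only [not_lt, not_forall] using mt norm_diskRows_lt_one_iff.1 hx.not_lt
  refine dim_schubertSymbol_echelonPlane_lt (isEchelon_diskRows b e x) (hi.antisymm' ?_)
  exact (norm_le_pi_norm _ i).trans ((norm_diskRows b e x).trans hx).le

theorem eq_of_characteristicMap_eq {x y : E a} (hx : ‖x‖ < 1) (hy : ‖y‖ ≤ 1)
    (h : characteristicMap b e y = characteristicMap b e x) : y = x := by
  have hy' : ‖y‖ < 1 := hy.lt_of_ne fun hy => by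
    have hlt := dim_schubertSymbol_characteristicMap_lt (b := b) (e := e) hy
    rw [h, schubertSymbol_characteristicMap hx] at hlt
    exact hlt.false
  exact diskRows_injective b e (eq_of_echelonPlane_eq (isEchelon_diskRows b e y)
    (isEchelon_diskRows b e x) (norm_diskRows_lt_one_iff.2 hy') (norm_diskRows_lt_one_iff.2 hx) h)

variable (e) in
theorem exists_characteristicMap_eq {l : Grassmannian n p}
    (hl : l.schubertSymbol b.toBasis = σ) : ∃ x, ‖x‖ < 1 ∧ characteristicMap b e x = l := by
  obtain ⟨t, h, ht, rfl⟩ := exists_echelonPlane_eq hl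
  obtain ⟨x, rfl⟩ := h.exists_diskRows_eq e
  exact ⟨x, norm_diskRows_lt_one_iff.1 ht, rfl⟩

end CharacteristicMap

end RepGrassmann

theorem mainTheorem12 {n p q : ℕ} (σ : RepGrassmann.SchubertSymbol n p)
    (φ : RepGrassmann.FlagSymbol p q) (V : ℕ → Submodule ℝ (RepGrassmann.E p))
    (hV : RepGrassmann.IsFlag φ V) :
    RepGrassmann.IsRepCell (RepGrassmann.Grassmannian.act (n := n) q)
      (RepGrassmann.skeletonBelow n V σ.dim) (σ.cell V) σ.dim (σ.twists φ) := by
  open RepGrassmann SchubertSymbol Metric in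
  obtain ⟨b, hVb, hb⟩ := hV.exists_orthonormalBasis
  obtain ⟨e, he⟩ := exists_equiv_fin_add_lt_iff (FreeEntry.IsTwisted φ) σ.card_freeEntry
    (σ.card_filter_isTwisted φ)
  have hcont := (continuous_characteristicMap b e).continuousOn (s := closedBall 0 1)
  refine ⟨σ.twists_le_dim φ, characteristicMap b e, hcont,
    fun x _ => characteristicMap_act hb he x, ?embedding, ?image, fun x hx => ?sphere⟩
  case embedding =>
    exact isEmbedding_domRestrict_of_isCompact (isCompact_closedBall 0 1) ball_subset_closedBall
      hcont fun x hx y hy =>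
        eq_of_characteristicMap_eq (mem_ball_zero_iff.1 hx) (mem_closedBall_zero_iff.1 hy)
  case image =>
    ext l
    simp only [Set.mem_image, mem_ball_zero_iff, mem_cell_iff hVb]
    refine ⟨?_, exists_characteristicMap_eq e⟩
    rintro ⟨x, hx, rfl⟩
    exact schubertSymbol_characteristicMap hx
  case sphere =>
    exact ⟨_, dim_schubertSymbol_characteristicMap_lt (mem_sphere_zero_iff_norm.1 hx),
      (mem_cell_iff hVb).2 rfl⟩
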